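/- A seller has $k\ge 1$ identical items, and $n$ buyers arrive one by one in a fixed order; $n$ is arbitrary. Their values $X_1,\dots,X_n\ge 0$ are independent random variables with continuous (atomless) distributions $\mathcal D_1,\dots,\mathcal D_n$, and before the sale the seller observes samples $Y_i\sim\mathcal D_i$, where $X_1,\dots,X_n,Y_1,\dots,Y_n$ are independent. Write $X^j$ for the $j$-th largest of $X_1,\dots,X_n$, with $X^j=0$ for $j>n$, and define $Y^j$ analogously. For $1\le r\le k$, pricing at $Y^r$ means: when buyer $i=1,\dots,n$ arrives, sell an item to that buyer if $X_i>Y^r$ and fewer than $k$ items have been sold so far. Let $ALG$ be the sum of the values of the buyers who are sold an item. The algorithm has competitive ratio at least $c$ (for given $k$ and $r$) if $\mathbb E[ALG]\ge c\cdot\mathbb E\left[\sum_{i=1}^k X^i\right]$ for every $n$ and all such distributions. Theorem. For all integers $1\le r\le k$, pricing at $Y^r$ has competitive ratio at least $$\frac{r\Pr(Z\le k-1)-r\,\binom{2r-1}{r}/2^{2r-1}}{k},\qquad Z\sim\mathrm{Bin}\left(r+k-1,\tfrac12\right).$$ In particular, with $r=k-\sqrt{2k\log k}$ (rounded up or down to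 an integer, $1\le r\le k$; natural logarithm) it has competitive ratio at least $1-\sqrt{\frac{2\log k}{k}}-\varepsilon(k)$, where $\varepsilon(k)$ depends only on $k$ and $\varepsilon(k)=O\left(\frac1{\sqrt k}\right)$ as $k\to\infty$; that is, $$\mathbb E[ALG]\ge\left(1-\sqrt{\frac{2\log k}{k}}-o\left(\sqrt{\frac{\log k}{k}}\right)\right)\mathbb E\left[\sum_{i=1}^k X^i\right].$$ -/

import Mathlib

open MeasureTheory ProbabilityTheory Filter Asymptotics

universe u

namespace SampleProphet

noncomputable section

/-- The `j`-th largest of the numbers `x 0, …, x (n-1)`, for `j ≥ 1`, counted with multiplicity;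
it is `0` for `j > n`. (`Tuple.sort x` lists the indices in increasing order of value. The value at
`j = 0` is a default that is never used.) -/
def largest {n : ℕ} (x : Fin n → ℝ) (j : ℕ) : ℝ :=
  if h : 1 ≤ j ∧ j ≤ n then x (Tuple.sort x ⟨n - j, by omega⟩) else 0

/-- One round of static pricing at price `p` with `k` items. The state is the number of items sold
so far together with the welfare collected so far, and `v` is the value of the arriving buyer. -/
def saleStep (k : ℕ) (p : ℝ) (s : ℕ × ℝ) (v : ℝ) : ℕ × ℝ :=
  if p < v ∧ s.1 < k then (s.1 + 1, s.2 + v) else s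

/-- The welfare collected by static pricing at price `p` with `k` items, when buyers with the values
`x 0, …, x (n-1)` arrive in this order. -/
def staticWelfare {n : ℕ} (k : ℕ) (p : ℝ) (x : Fin n → ℝ) : ℝ :=
  ((List.ofFn x).foldl (saleStep k p) (0, 0)).2

/-- The welfare collected with `k` items, when the price is the `r`-th largest of the samples
`y 0, …, y (n-1)`. -/
def samplePricingWelfare {n : ℕ} (k r : ℕ) (x y : Fin n → ℝ) : ℝ :=
  staticWelfare k (largest y r) x

/-- The welfare of the prophet: the sum of the `k` largest values. -/
def prophetWelfare {n : ℕ} (k : ℕ) (x : Fin n → ℝ) : ℝ :=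
  ∑ j ∈ Finset.Icc 1 k, largest x j

/-- Values `X i` and samples `Y i` of `n` buyers: all `2n` random variables are independent, `Y i`
has the same distribution as `X i`, and this distribution is continuous (it has no atoms) and
lives on the nonnegative reals. -/
structure IsSingleSampleInstance {Ω : Type*} [MeasurableSpace Ω] (P : Measure Ω) {n : ℕ}
    (X Y : Fin n → Ω → ℝ) : Prop where
  measurable_value : ∀ i, Measurable (X i)
  measurable_sample : ∀ i, Measurable (Y i)
  indep : iIndepFun (Sum.elim X Y) P
  identDistrib : ∀ i, IdentDistrib (X i) (Y i) P P
  noAtoms : ∀ i a, P {ω | X i ω = a} = 0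
  nonneg : ∀ i, ∀ᵐ ω ∂P, 0 ≤ X i ω

/-- Pricing `k` items at the `r`-th largest sample has competitive ratio at least `c`: for every
number of buyers and all value distributions, the expected welfare is at least `c` times the
expected welfare of the prophet. Both expectations are taken in `[0, ∞]`, so that values of infinite
mean are covered as well; a negative `c` asserts nothing, and indeed the welfare is nonnegative. -/
def HasCompetitiveRatio (k r : ℕ) (c : ℝ) : Prop :=
  ∀ (Ω : Type u) [MeasurableSpace Ω] (P : Measure Ω) [IsProbabilityMeasure P] (n : ℕ)
    (X Y : Fin n → Ω → ℝ), IsSingleSampleInstance P X Y →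
    ENNReal.ofReal c * ∫⁻ ω, ENNReal.ofReal (prophetWelfare k fun i => X i ω) ∂P ≤
      ∫⁻ ω, ENNReal.ofReal (samplePricingWelfare k r (fun i => X i ω) fun i => Y i ω) ∂P

/-- The number `1/2` as a success probability. -/
def half : unitInterval := ⟨1 / 2, by norm_num, by norm_num⟩

end

end SampleProphet

namespace SampleProphet

/-- The probability that `m` fair coins show at least `k` heads. -/
noncomputable def binTail : ℕ → ℤ → ℝ
  | 0, k => if k ≤ 0 then 1 else 0
  | m + 1, k => (binTail m (k - 1) + binTail m k) / 2

lemma binTail_zero (k : ℤ) : binTail 0 k = if k ≤ 0 then 1 else 0 := rfl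

lemma binTail_succ (m : ℕ) (k : ℤ) :
    binTail (m + 1) k = (binTail m (k - 1) + binTail m k) / 2 := rfl

lemma binTail_nonneg (m : ℕ) (k : ℤ) : 0 ≤ binTail m k := by
  induction m generalizing k with
  | zero => rw [binTail_zero]; split_ifs <;> norm_num
  | succ m ih => rw [binTail_succ]; linarith [ih k, ih (k - 1)]

lemma binTail_of_nonpos (m : ℕ) {k : ℤ} (hk : k ≤ 0) : binTail m k = 1 := by
  induction m generalizing k with
  | zero => simp [binTail_zero, hk]
  | succ m ih => rw [binTail_succ, ih hk, ih (by lia)]; norm_num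

lemma binTail_antitone (m : ℕ) : Antitone (binTail m) := by
  induction m with
  | zero =>
    intro a b hab
    simp only [binTail_zero]
    split_ifs <;> first | lia | norm_num
  | succ m ih =>
    intro a b hab
    simp only [binTail_succ]
    linarith [ih hab, ih (show a - 1 ≤ b - 1 by lia)]

lemma binTail_monotone_left (k : ℤ) : Monotone fun m => binTail m k := by
  refine monotone_nat_of_le_succ fun m => ?_
  rw [binTail_succ]
  linarith [binTail_antitone m (show k - 1 ≤ k by lia)]

lemma binTail_eq_add_choose (m k : ℕ) :
    binTail m k = binTail m (k + 1) + (m.choose k : ℝ) / 2 ^ m := by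
  induction m generalizing k with
  | zero =>
    rcases k with _ | k
    · simp [binTail_zero]
    · simp only [binTail_zero]
      rw [if_neg (by push_cast; lia), if_neg (by push_cast; lia)]
      simp
  | succ m ih =>
    rcases k with _ | k
    · have h := ih 0
      simp only [binTail_succ, Nat.cast_zero, zero_add] at h ⊢
      rw [binTail_of_nonpos m (show (0 : ℤ) - 1 ≤ 0 by lia)]
      rw [binTail_of_nonpos m le_rfl] at h
      rw [sub_self, binTail_of_nonpos m le_rfl]
      simp only [Nat.choose_zero_right, Nat.cast_one, pow_succ] at h ⊢
      rw [show (1 : ℝ) / (2 ^ m * 2) = 1 / 2 ^ m / 2 by rw [div_div]]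
      linarith
    · have h := ih k
      have h' := ih (k + 1)
      simp only [binTail_succ]
      push_cast at h h' ⊢
      rw [show (k : ℤ) + 1 - 1 = k by ring, show (k : ℤ) + 1 + 1 - 1 = k + 1 by ring,
        Nat.choose_succ_succ]
      push_cast
      rw [h, h', pow_succ]
      field_simp
      ring

lemma binTail_pred_le {m k : ℕ} (h : m + 3 ≤ 2 * k) :
    binTail m (k - 1) ≤ binTail (m + 2) k := by
  obtain ⟨l, rfl⟩ : ∃ l, k = l + 2 := ⟨k - 2, by lia⟩
  have hc : (m.choose (l + 1) : ℝ) ≤ m.choose l := by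
    have h1 := Nat.choose_succ_right_eq m l
    have h2 : m.choose l * (m - l) ≤ m.choose l * (l + 1) := Nat.mul_le_mul_left _ (by lia)
    exact_mod_cast Nat.le_of_mul_le_mul_right (h1.trans_le h2) (Nat.succ_pos l)
  have h1 := binTail_eq_add_choose m l
  have h2 := binTail_eq_add_choose m (l + 1)
  have h3 : (m.choose (l + 1) : ℝ) / 2 ^ m ≤ m.choose l / 2 ^ m := by gcongr
  simp only [binTail_succ]
  push_cast at h1 h2 ⊢
  rw [show (l : ℤ) + 2 - 1 - 1 = l by ring, show (l : ℤ) + 2 - 1 = l + 1 by ring,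
    show (l : ℤ) + 2 = l + 1 + 1 by ring]
  linarith

lemma binTail_sub_le (s c k : ℕ) (h : s + 2 * c + 1 ≤ 2 * k) :
    binTail s (k - c) ≤ binTail (s + 2 * c) k := by
  induction c generalizing k with
  | zero => simp
  | succ c ih =>
    have h1 := ih (k - 1) (by lia)
    have h2 := binTail_pred_le (m := s + 2 * c) (k := k) (by lia)
    have hk : ((k - 1 : ℕ) : ℤ) = k - 1 := by lia
    rw [hk] at h1
    rw [show s + 2 * (c + 1) = s + 2 * c + 2 by ring]
    push_cast
    rw [show (k : ℤ) - (c + 1) = k - 1 - c by ring]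
    exact h1.trans h2

lemma sum_range_choose_eq_one_sub_binTail (m k : ℕ) :
    ∑ j ∈ Finset.range k, (m.choose j : ℝ) / 2 ^ m = 1 - binTail m k := by
  induction k with
  | zero => simp [binTail_of_nonpos]
  | succ k ih =>
    rw [Finset.sum_range_succ, ih, binTail_eq_add_choose m k]
    push_cast
    ring

lemma binomial_half_real_le {m k : ℕ} (hk : 1 ≤ k) :
    (binomial m half).real {z : ℕ | z ≤ k - 1} = 1 - binTail m k := by
  have hs : {z : ℕ | z ≤ k - 1} = ((Finset.range k : Finset ℕ) : Set ℕ) := by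
    ext z
    simp only [Set.mem_ofPred_eq, Finset.coe_range, Set.mem_Iio]
    lia
  rw [hs, ← sum_measureReal_singleton, ← sum_range_choose_eq_one_sub_binTail]
  refine Finset.sum_congr rfl fun j _ => ?_
  rw [binomial_real_singleton]
  rcases le_or_gt j m with hj | hj
  · have : (half : ℝ) = 1 / 2 := rfl
    rw [this, show (1 : ℝ) - 1 / 2 = 1 / 2 by norm_num, mul_assoc, ← pow_add,
      Nat.add_sub_cancel' hj, one_div, inv_pow, div_eq_mul_inv]
  · simp [Nat.choose_eq_zero_of_lt hj]

lemma sum_range_binTail (M r : ℕ) :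
    ∑ m ∈ Finset.range M, binTail m r =
      (M - 2 * r) * binTail M r + r * ((M.choose r : ℝ) / 2 ^ M) := by
  induction M with
  | zero =>
    rcases r with _ | r
    · simp [binTail_zero]
    · simp only [Finset.range_zero, Finset.sum_empty, binTail_zero]
      rw [if_neg (by push_cast; lia)]
      simp
  | succ M ih =>
    rw [Finset.sum_range_succ, ih, binTail_succ]
    rcases r with _ | r
    · rw [binTail_of_nonpos _ (by simp), binTail_of_nonpos _ (by simp)]
      simp
    · have h1 := binTail_eq_add_choose M r
      have h2 : (M.choose (r + 1) : ℝ) * (r + 1) = M.choose r * (M - r) := by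
        rcases le_or_gt r M with h | h
        · rw [← Nat.cast_sub h]
          exact_mod_cast Nat.choose_succ_right_eq M r
        · simp [Nat.choose_eq_zero_of_lt h, Nat.choose_eq_zero_of_lt (h.trans (Nat.lt_succ_self r))]
      push_cast at h1 ⊢
      rw [add_sub_cancel_right, h1, Nat.choose_succ_succ, pow_succ]
      push_cast
      have h3 : ((r : ℝ) + 1) * (M.choose (r + 1) / 2 ^ M) = M.choose r / 2 ^ M * (M - r) := by
        rw [mul_div_assoc', mul_comm, h2]; ring
      rw [show ((M.choose r : ℝ) + M.choose (r + 1)) / (2 ^ M * 2) =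
        (M.choose r / 2 ^ M + M.choose (r + 1) / 2 ^ M) / 2 by field_simp]
      linear_combination h3 / 2

lemma sum_range_two_mul_binTail {r : ℕ} (hr : 1 ≤ r) :
    ∑ m ∈ Finset.range (2 * r), binTail m r =
      r * (((2 * r - 1).choose r : ℝ) / 2 ^ (2 * r - 1)) := by
  obtain ⟨q, rfl⟩ : ∃ q, r = q + 1 := ⟨r - 1, by lia⟩
  have h : (2 * (q + 1)).choose (q + 1) = 2 * (2 * q + 1).choose (q + 1) := by
    rw [show 2 * (q + 1) = (2 * q + 1) + 1 by ring, Nat.choose_succ_succ,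
      Nat.choose_symm_half]
    ring
  rw [sum_range_binTail, h, show 2 * (q + 1) - 1 = 2 * q + 1 by lia,
    show 2 * (q + 1) = (2 * q + 1) + 1 by ring, pow_succ]
  push_cast
  field_simp
  ring

lemma binTail_le_exp (m : ℕ) (k : ℤ) (l : ℝ) (hl : 0 ≤ l) :
    binTail m k ≤ Real.exp (-l * k + m * (l / 2 + l ^ 2 / 8)) := by
  induction m generalizing k with
  | zero =>
    rw [binTail_zero]
    split_ifs with h
    · rw [Real.one_le_exp_iff]
      have : (k : ℝ) ≤ 0 := by exact_mod_cast h
      simp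
      nlinarith
    · positivity
  | succ m ih =>
    rw [binTail_succ]
    have h1 := ih (k - 1)
    have h2 := ih k
    set a := -l * k + m * (l / 2 + l ^ 2 / 8) with ha
    have e1 : -l * ((k - 1 : ℤ) : ℝ) + m * (l / 2 + l ^ 2 / 8) = a + l / 2 + l / 2 := by
      push_cast; rw [ha]; ring
    have e2 : a = a + l / 2 + -(l / 2) := by ring
    rw [e1, Real.exp_add] at h1
    rw [e2, Real.exp_add] at h2
    have e3 : -l * k + ((m + 1 : ℕ) : ℝ) * (l / 2 + l ^ 2 / 8) = a + l / 2 + (l / 2) ^ 2 / 2 := by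
      push_cast; rw [ha]; ring
    rw [e3, Real.exp_add]
    have h4 := Real.cosh_le_exp_half_sq (l / 2)
    rw [Real.cosh_eq] at h4
    have h5 := mul_le_mul_of_nonneg_left h4 (Real.exp_pos (a + l / 2)).le
    linarith

lemma centralBinom_sq_mul_le (q : ℕ) :
    (q.centralBinom : ℝ) ^ 2 * (2 * q + 1) ≤ (4 ^ q) ^ 2 := by
  induction q with
  | zero => norm_num [Nat.centralBinom]
  | succ q ih =>
    have h' : ((q : ℝ) + 1) * (q + 1).centralBinom = 2 * (2 * q + 1) * q.centralBinom := by
      exact_mod_cast Nat.succ_mul_centralBinom_succ q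
    have hq : (0 : ℝ) < q + 1 := by positivity
    have h2 : ((q : ℝ) + 1) ^ 2 * ((q + 1).centralBinom ^ 2 * (2 * ((q + 1 : ℕ) : ℝ) + 1)) =
        4 * (2 * q + 1) * (2 * q + 3) * (q.centralBinom ^ 2 * (2 * q + 1)) := by
      push_cast
      linear_combination (2 * (q : ℝ) + 3) * (((q : ℝ) + 1) * (q + 1).centralBinom +
        2 * (2 * q + 1) * q.centralBinom) * h'
    refine le_of_mul_le_mul_left ?_ (pow_pos hq 2)
    rw [h2]
    refine (mul_le_mul_of_nonneg_left ih (by positivity)).trans ?_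
    rw [pow_succ (4 : ℝ) q]
    nlinarith [sq_nonneg ((4 : ℝ) ^ q)]

lemma mul_choose_div_le_sqrt {r : ℕ} (hr : 1 ≤ r) :
    (r : ℝ) * (((2 * r - 1).choose r : ℝ) / 2 ^ (2 * r - 1)) ≤ √r := by
  obtain ⟨q, rfl⟩ : ∃ q, r = q + 1 := ⟨r - 1, by lia⟩
  have h : (q + 1).centralBinom = 2 * (2 * q + 1).choose (q + 1) := by
    rw [Nat.centralBinom, show 2 * (q + 1) = (2 * q + 1) + 1 by ring, Nat.choose_succ_succ,
      Nat.choose_symm_half]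
    ring
  have h1 := centralBinom_sq_mul_le (q + 1)
  have h2 : (((2 * (q + 1) - 1).choose (q + 1) : ℝ) / 2 ^ (2 * (q + 1) - 1)) =
      (q + 1).centralBinom / 4 ^ (q + 1) := by
    rw [h, show (4 : ℝ) = 2 ^ 2 by norm_num, ← pow_mul, show 2 * (q + 1) - 1 = 2 * q + 1 by lia,
      show 2 * (q + 1) = (2 * q + 1) + 1 by ring, pow_succ]
    push_cast
    field_simp
    ring
  rw [h2]
  refine Real.le_sqrt_of_sq_le ?_
  rw [mul_pow, div_pow]
  have hp : (0 : ℝ) < (4 ^ (q + 1)) ^ 2 := by positivity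
  have h3 : ((q + 1).centralBinom : ℝ) ^ 2 / (4 ^ (q + 1)) ^ 2 * (2 * ((q + 1 : ℕ) : ℝ) + 1) ≤ 1 := by
    rw [div_mul_eq_mul_div, div_le_one hp]
    exact h1
  have h4 : (0 : ℝ) ≤ ((q + 1).centralBinom : ℝ) ^ 2 / (4 ^ (q + 1)) ^ 2 := by positivity
  set x := ((q + 1).centralBinom : ℝ) ^ 2 / (4 ^ (q + 1)) ^ 2
  set y := ((q + 1 : ℕ) : ℝ)
  have hy : 0 ≤ y := Nat.cast_nonneg _
  nlinarith [mul_nonneg h4 hy]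

lemma largest_lt_iff {n : ℕ} (x : Fin n → ℝ) {j : ℕ} (h1 : 1 ≤ j) (hn : j ≤ n) (t : ℝ) :
    largest x j < t ↔ Finset.card {i | t ≤ x i} < j := by
  have h : (⟨n - j, by lia⟩ : Fin n).val <
      Finset.card {i : Fin n | (x ∘ Tuple.sort x) i < t} ↔ _ :=
    Tuple.lt_card_lt_iff_apply_lt_of_monotone (a := t) (Tuple.monotone_sort x)
  have e : Finset.card {i : Fin n | (x ∘ Tuple.sort x) i < t} = Finset.card {i : Fin n | x i < t} :=
    Finset.card_equiv (Tuple.sort x) (by simp)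
  have h2 := Finset.card_filter_add_card_filter_not (s := (Finset.univ : Finset (Fin n)))
    (fun i => x i < t)
  simp only [not_lt, Finset.card_univ, Fintype.card_fin] at h2
  rw [largest, dif_pos ⟨h1, hn⟩]
  change (x ∘ Tuple.sort x) _ < t ↔ _
  rw [← h, e]
  simp only
  lia

lemma le_largest_iff {n : ℕ} (x : Fin n → ℝ) {j : ℕ} (h1 : 1 ≤ j) (hn : j ≤ n) (t : ℝ) :
    t ≤ largest x j ↔ j ≤ Finset.card {i | t ≤ x i} := by
  rw [← not_lt, largest_lt_iff x h1 hn, not_lt]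

lemma largest_le_iff {n : ℕ} (x : Fin n → ℝ) {j : ℕ} (h1 : 1 ≤ j) (hn : j ≤ n) (t : ℝ) :
    largest x j ≤ t ↔ Finset.card {i | t < x i} < j := by
  have h : (⟨n - j, by lia⟩ : Fin n).val <
      Finset.card {i : Fin n | (x ∘ Tuple.sort x) i ≤ t} ↔ _ :=
    Tuple.lt_card_le_iff_apply_le_of_monotone (a := t) (Tuple.monotone_sort x)
  have e : Finset.card {i : Fin n | (x ∘ Tuple.sort x) i ≤ t} = Finset.card {i : Fin n | x i ≤ t} :=
    Finset.card_equiv (Tuple.sort x) (by simp)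
  have h2 := Finset.card_filter_add_card_filter_not (s := (Finset.univ : Finset (Fin n)))
    (fun i => x i ≤ t)
  simp only [not_le, Finset.card_univ, Fintype.card_fin] at h2
  rw [largest, dif_pos ⟨h1, hn⟩]
  change (x ∘ Tuple.sort x) _ ≤ t ↔ _
  rw [← h, e]
  simp only
  lia

lemma largest_of_lt {n : ℕ} (x : Fin n → ℝ) {j : ℕ} (h : n < j) : largest x j = 0 := by
  rw [largest, dif_neg (by lia)]

@[fun_prop]
lemma measurable_largest {n : ℕ} (j : ℕ) : Measurable fun x : Fin n → ℝ => largest x j := by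
  by_cases h : 1 ≤ j ∧ j ≤ n
  · refine measurable_of_Ici fun t => ?_
    have e : (fun x : Fin n → ℝ => largest x j) ⁻¹' Set.Ici t =
        {x | (j : ℝ) ≤ ∑ i : Fin n, (Set.Ici t).indicator 1 (x i)} := by
      ext x
      simp only [Set.mem_preimage, Set.mem_Ici, le_largest_iff x h.1 h.2, Set.mem_ofPred_eq]
      rw [Finset.card_eq_sum_ones, Finset.sum_filter, ← Nat.cast_le (α := ℝ)]
      push_cast
      simp [Set.indicator_apply]
    rw [e]
    refine measurableSet_le measurable_const (Finset.measurable_sum _ fun i _ => ?_)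
    exact (measurable_one.indicator measurableSet_Ici).comp (measurable_pi_apply i)
  · simp only [largest, dif_neg h]
    exact measurable_const

lemma prophetWelfare_le {n : ℕ} (k : ℕ) (x : Fin n → ℝ) {t : ℝ} (ht : 0 ≤ t) :
    prophetWelfare k x ≤ k * t + ∑ i, max (x i - t) 0 := by
  have h : prophetWelfare k x ≤ ∑ j ∈ Finset.Icc 1 k, (t + max (largest x j - t) 0) :=
    Finset.sum_le_sum fun j _ => by linarith [le_max_left (largest x j - t) 0]
  refine h.trans ?_
  rw [Finset.sum_add_distrib]
  simp only [Finset.sum_const, Nat.card_Icc, add_tsub_cancel_right, nsmul_eq_mul]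
  gcongr
  have h2 : ∑ j ∈ Finset.Icc 1 k, max (largest x j - t) 0 ≤
      ∑ j ∈ Finset.Icc 1 n, max (largest x j - t) 0 := by
    rw [← Finset.sum_filter_of_ne (p := (· ≤ n))]
    · refine Finset.sum_le_sum_of_subset_of_nonneg (fun j hj => ?_) fun _ _ _ => le_max_right _ _
      rw [Finset.mem_filter, Finset.mem_Icc] at hj
      exact Finset.mem_Icc.2 ⟨hj.1.1, hj.2⟩
    · intro j _ hne
      by_contra! hn
      rw [largest_of_lt x hn] at hne
      exact hne (max_eq_right (by linarith))
  refine h2.trans_eq ?_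
  symm
  rw [← Equiv.sum_comp (Tuple.sort x)]
  refine Finset.sum_bij' (fun i _ => n - i.val) (fun j hj => ⟨n - j, by
    rw [Finset.mem_Icc] at hj; lia⟩) ?_ ?_ ?_ ?_ ?_
  · intro i _
    rw [Finset.mem_Icc]
    lia
  · simp
  · intro i _
    ext
    simp
    lia
  · intro j hj
    rw [Finset.mem_Icc] at hj
    simp
    lia
  · intro i _
    have : (⟨n - (n - i.val), by lia⟩ : Fin n) = i := by ext; simp; lia
    rw [largest, dif_pos (by lia), this]

lemma prophetWelfare_nonneg {n : ℕ} (k : ℕ) {x : Fin n → ℝ} (hx : ∀ i, 0 ≤ x i) :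
    0 ≤ prophetWelfare k x := by
  refine Finset.sum_nonneg fun j _ => ?_
  rw [largest]
  split_ifs
  exacts [hx _, le_rfl]

lemma foldl_saleStep (k : ℕ) (p : ℝ) (l : List ℝ) (s : ℕ × ℝ)
    (h : s.1 + (l.map fun v => if p < v then 1 else 0).sum ≤ k) :
    (l.foldl (saleStep k p) s).2 = s.2 + (l.map fun v => if p < v then v else 0).sum := by
  induction l generalizing s with
  | nil => simp
  | cons v l ih =>
    rw [List.foldl_cons]
    rw [List.map_cons, List.sum_cons] at h ⊢
    by_cases hv : p < v
    · rw [if_pos hv] at h ⊢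
      have e : saleStep k p s v = (s.1 + 1, s.2 + v) := by
        rw [saleStep, if_pos ⟨hv, by lia⟩]
      rw [e, ih _ (by simp only; lia)]
      ring
    · rw [if_neg hv] at h ⊢
      have e : saleStep k p s v = s := by
        rw [saleStep, if_neg (fun h => hv h.1)]
      rw [e, ih _ (by lia), zero_add]

lemma staticWelfare_eq_sum {n : ℕ} {k : ℕ} {p : ℝ} {x : Fin n → ℝ}
    (h : Finset.card {i | p < x i} ≤ k) :
    staticWelfare k p x = ∑ i, if p < x i then x i else 0 := by
  rw [staticWelfare, foldl_saleStep]
  · simp [List.map_ofFn, List.sum_ofFn]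
  · rw [Finset.card_filter] at h
    simpa [List.map_ofFn, List.sum_ofFn] using h

lemma foldl_saleStep_nonneg (k : ℕ) (p : ℝ) (l : List ℝ) (hl : ∀ v ∈ l, 0 ≤ v) (s : ℕ × ℝ)
    (hs : 0 ≤ s.2) : 0 ≤ (l.foldl (saleStep k p) s).2 := by
  induction l generalizing s with
  | nil => simpa
  | cons v l ih =>
    rw [List.foldl_cons]
    refine ih (fun w hw => hl w (List.mem_cons_of_mem _ hw)) _ ?_
    rw [saleStep]
    split_ifs
    · exact add_nonneg hs (hl v List.mem_cons_self)
    · exact hs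

lemma staticWelfare_nonneg {n : ℕ} (k : ℕ) (p : ℝ) {x : Fin n → ℝ} (hx : ∀ i, 0 ≤ x i) :
    0 ≤ staticWelfare k p x := by
  refine foldl_saleStep_nonneg k p _ (fun v hv => ?_) _ le_rfl
  obtain ⟨i, rfl⟩ := (List.mem_ofFn' x v).1 hv
  exact hx i

lemma samplePricingWelfare_nonneg {n : ℕ} (k r : ℕ) {x : Fin n → ℝ} (y : Fin n → ℝ)
    (hx : ∀ i, 0 ≤ x i) : 0 ≤ samplePricingWelfare k r x y :=
  staticWelfare_nonneg k _ hx

lemma measurable_foldl_saleStep {α : Type*} [MeasurableSpace α] (k : ℕ) {q : α → ℝ}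
    (hq : Measurable q) (l : List (α → ℝ)) (hl : ∀ f ∈ l, Measurable f) {s : α → ℕ × ℝ}
    (hs : Measurable s) :
    Measurable fun a => (l.map (· a)).foldl (saleStep k (q a)) (s a) := by
  induction l generalizing s with
  | nil => simpa
  | cons f l ih =>
    simp only [List.map_cons, List.foldl_cons]
    refine ih (fun g hg => hl g (List.mem_cons_of_mem _ hg)) ?_
    have hf := hl f List.mem_cons_self
    refine Measurable.ite ((measurableSet_lt hq hf).inter
      (measurableSet_lt hs.fst measurable_const)) ?_ hs
    exact (hs.fst.add_const 1).prodMk (hs.snd.add hf)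

lemma measurable_samplePricingWelfare {n : ℕ} (k r : ℕ) :
    Measurable fun z : (Fin n → ℝ) × (Fin n → ℝ) => samplePricingWelfare k r z.1 z.2 := by
  have h := (measurable_foldl_saleStep k ((measurable_largest r).comp
    (measurable_snd : Measurable (Prod.snd : (Fin n → ℝ) × (Fin n → ℝ) → _)))
    (List.ofFn fun i z => z.1 i) (fun f hf => by
      obtain ⟨i, rfl⟩ := (List.mem_ofFn' _ f).1 hf
      fun_prop) (measurable_const (a := ((0, 0) : ℕ × ℝ)))).snd
  simp only [List.map_ofFn] at h
  exact h

lemma measurable_prophetWelfare {n : ℕ} (k : ℕ) :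
    Measurable fun x : Fin n → ℝ => prophetWelfare k x :=
  Finset.measurable_sum _ fun j _ => measurable_largest j

/-- The number of elements of `s` with a larger value than `e`. -/
noncomputable def rankIn {α : Type*} (v : α → ℝ) (s : Finset α) (e : α) : ℕ :=
  Finset.card {f ∈ s | v e < v f}

section Rank

variable {α : Type*} {v : α → ℝ} {s : Finset α}

lemma rankIn_lt_rankIn {e f : α} (hf : f ∈ s) (h : v e < v f) : rankIn v s f < rankIn v s e := by
  refine Finset.card_lt_card (Finset.ssubset_iff_of_subset ?_ |>.2 ⟨f, ?_, ?_⟩)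
  · exact Finset.monotone_filter_right _ fun g _ hg => h.trans hg
  · exact Finset.mem_filter.2 ⟨hf, h⟩
  · simp

lemma rankIn_lt_card {e : α} (he : e ∈ s) : rankIn v s e < s.card := by
  refine Finset.card_lt_card (Finset.ssubset_iff_of_subset (Finset.filter_subset _ _) |>.2
    ⟨e, he, ?_⟩)
  simp

lemma rankIn_injOn (hv : Set.InjOn v s) : Set.InjOn (rankIn v s) s := by
  intro e he f hf h
  by_contra hne
  rcases lt_or_gt_of_ne (fun h' => hne (hv he hf h')) with h' | h'
  · exact (rankIn_lt_rankIn hf h').ne' h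
  · exact (rankIn_lt_rankIn he h').ne h

lemma image_rankIn (hv : Set.InjOn v s) : s.image (rankIn v s) = Finset.range s.card := by
  refine Finset.eq_of_subset_of_card_le (fun m hm => ?_) ?_
  · obtain ⟨e, he, rfl⟩ := Finset.mem_image.1 hm
    exact Finset.mem_range.2 (rankIn_lt_card he)
  · rw [Finset.card_range, Finset.card_image_of_injOn (rankIn_injOn hv)]

lemma sum_rankIn (hv : Set.InjOn v s) {m : ℕ} (hm : m ≤ s.card) (a : ℕ → ℝ) :
    ∑ e ∈ s with rankIn v s e < m, a (rankIn v s e) = ∑ j ∈ Finset.range m, a j := by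
  have h : Finset.image (rankIn v s) {e ∈ s | rankIn v s e < m} = Finset.range m := by
    ext j
    simp only [Finset.mem_image, Finset.mem_filter, Finset.mem_range]
    constructor
    · rintro ⟨e, he, rfl⟩
      exact he.2
    · intro hj
      have : j ∈ s.image (rankIn v s) := by
        rw [image_rankIn hv]
        exact Finset.mem_range.2 (hj.trans_le hm)
      obtain ⟨e, he, rfl⟩ := Finset.mem_image.1 this
      exact ⟨e, ⟨he, hj⟩, rfl⟩
  rw [← h, Finset.sum_image]
  exact (rankIn_injOn hv).mono (Finset.filter_subset _ _)

lemma card_rankIn_lt (hv : Set.InjOn v s) {m : ℕ} (hm : m ≤ s.card) :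
    Finset.card {e ∈ s | rankIn v s e < m} = m := by
  have h := sum_rankIn hv hm fun _ => 1
  simp only [Finset.sum_const, Finset.card_range, nsmul_eq_mul, mul_one] at h
  exact_mod_cast h

end Rank

/-- The number of elements of `D` that the coin flips `σ` select. -/
def selected {n : ℕ} (σ : Fin n → Bool) (D : Finset (Fin n × Bool)) : ℕ :=
  Finset.card {e ∈ D | σ e.1 = e.2}

lemma selected_eq_sum {n : ℕ} (σ : Fin n → Bool) (D : Finset (Fin n × Bool)) :
    selected σ D = ∑ i, if (i, σ i) ∈ D then 1 else 0 := by
  rw [selected, ← Finset.card_filter]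
  refine Finset.card_nbij' (fun e => e.1) (fun i => (i, σ i)) ?_ ?_ ?_ ?_
  · rintro ⟨i, b⟩ h
    simp only [Finset.coe_filter, Set.mem_ofPred_eq, Finset.mem_univ, true_and] at h ⊢
    rw [h.2]
    exact h.1
  · intro i h
    simpa using h
  · rintro ⟨i, b⟩ h
    simp at h
    simp [h.2]
  · intro i _
    rfl

lemma sum_fin_succ_bool {n : ℕ} (F : (Fin (n + 1) → Bool) → ℝ) :
    ∑ σ, F σ = ∑ σ : Fin n → Bool, F (Fin.cons true σ) + ∑ σ : Fin n → Bool, F (Fin.cons false σ) := by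
  rw [← (Fin.consEquiv fun _ => Bool).sum_comp, Fintype.sum_prod_type, Fintype.sum_bool]
  rfl

lemma sum_coins_eq_binTail {n : ℕ} (a : Fin n → Bool → Prop) [∀ i b, Decidable (a i b)] (k : ℤ) :
    ∑ σ : Fin n → Bool, (if k ≤ ((∑ i, if a i (σ i) then 1 else 0 : ℕ) : ℤ) then (1 : ℝ) else 0) =
      2 ^ n * binTail (∑ i, if (a i true ↔ a i false) then 0 else 1)
        (k - (∑ i, if a i true ∧ a i false then 1 else 0 : ℕ)) := by
  induction n generalizing k with
  | zero => simp [binTail_zero]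
  | succ n ih =>
    rw [sum_fin_succ_bool]
    have e (b : Bool) : ∑ σ : Fin n → Bool, (if k ≤ ((∑ i, if a i ((Fin.cons b σ : Fin (n + 1) → Bool) i)
          then 1 else 0 : ℕ) : ℤ) then (1 : ℝ) else 0) =
        ∑ σ : Fin n → Bool, (if (k - if a 0 b then 1 else 0) ≤
          ((∑ i, if a (Fin.succ i) (σ i) then 1 else 0 : ℕ) : ℤ) then (1 : ℝ) else 0) := by
      refine Finset.sum_congr rfl fun σ _ => if_congr ?_ rfl rfl
      rw [Fin.sum_univ_succ]
      simp only [Fin.cons_zero, Fin.cons_succ]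
      split_ifs <;> push_cast <;> constructor <;> intro h <;> linarith
    rw [e, e, ih (fun i => a i.succ), ih (fun i => a i.succ), Fin.sum_univ_succ, Fin.sum_univ_succ]
    set s := ∑ i : Fin n, if (a i.succ true ↔ a i.succ false) then 0 else 1
    set c := ∑ i : Fin n, if a i.succ true ∧ a i.succ false then 1 else 0
    by_cases h1 : a 0 true <;> by_cases h2 : a 0 false <;>
      simp only [h1, h2, if_true, if_false, and_true, and_false, iff_true, iff_false, not_true,
        zero_add, sub_zero, pow_succ]
    · push_cast
      rw [show k - 1 - (c : ℤ) = k - (1 + c) by ring]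
      ring
    · rw [add_comm 1 s, binTail_succ, show k - 1 - (c : ℤ) = k - c - 1 by ring]
      ring
    · rw [add_comm 1 s, binTail_succ, show k - 1 - (c : ℤ) = k - c - 1 by ring]
      ring
    · ring

lemma sum_coins_le_selected {n : ℕ} (D : Finset (Fin n × Bool)) {k : ℕ} (h : D.card + 1 ≤ 2 * k) :
    ∑ σ : Fin n → Bool, (if k ≤ selected σ D then (1 : ℝ) else 0) ≤ 2 ^ n * binTail D.card k := by
  have h1 := sum_coins_eq_binTail (fun i b => (i, b) ∈ D) k
  have hc : D.card = (∑ i, if ((i, true) ∈ D ↔ (i, false) ∈ D) then 0 else 1) +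
      2 * (∑ i : Fin n, if (i, true) ∈ D ∧ (i, false) ∈ D then 1 else 0) := by
    have : D.card = ∑ e : Fin n × Bool, if e ∈ D then 1 else 0 := by
      rw [← Finset.card_filter]
      simp
    rw [this, Fintype.sum_prod_type, Finset.mul_sum, ← Finset.sum_add_distrib]
    refine Finset.sum_congr rfl fun i _ => ?_
    rw [Fintype.sum_bool]
    by_cases h1 : (i, true) ∈ D <;> by_cases h2 : (i, false) ∈ D <;> simp [h1, h2]
  simp only [← selected_eq_sum, Nat.cast_le] at h1
  rw [h1]
  gcongr
  rw [hc] at h ⊢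
  exact binTail_sub_le _ _ _ h

lemma sum_coins_le_not_selected {n : ℕ} (D : Finset (Fin n × Bool)) {k : ℕ}
    (h : D.card + 1 ≤ 2 * k) :
    ∑ σ : Fin n → Bool, (if k ≤ Finset.card {e ∈ D | σ e.1 ≠ e.2} then (1 : ℝ) else 0) ≤
      2 ^ n * binTail D.card k := by
  refine le_trans (le_of_eq ?_) (sum_coins_le_selected D h)
  rw [← (Equiv.piCongrRight fun _ : Fin n => Equiv.boolNot).sum_comp]
  refine Finset.sum_congr rfl fun σ _ => if_congr ?_ rfl rfl
  simp [selected]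

lemma sum_coins_fixed {n : ℕ} (i : Fin n) (b : Bool) (F : (Fin n → Bool) → ℝ)
    (hF : ∀ σ c, F (Function.update σ i c) = F σ) :
    ∑ σ, (if σ i = b then F σ else 0) = (∑ σ, F σ) / 2 := by
  have hinv : Function.Involutive fun σ : Fin n → Bool => Function.update σ i (!σ i) := by
    intro σ
    simp
  have h : ∑ σ, (if σ i = b then F σ else 0) = ∑ σ, (if σ i = b then 0 else F σ) := by
    rw [← Equiv.sum_comp (hinv.toPerm _)]
    refine Finset.sum_congr rfl fun σ _ => ?_
    simp only [Function.Involutive.coe_toPerm, hF, Function.update_self]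
    cases σ i <;> cases b <;> rfl
  have h2 : ∑ σ, (if σ i = b then F σ else 0) + ∑ σ, (if σ i = b then 0 else F σ) = ∑ σ, F σ := by
    rw [← Finset.sum_add_distrib]
    refine Finset.sum_congr rfl fun σ _ => ?_
    split_ifs <;> simp
  linarith

lemma sum_coins_sum_selected {n : ℕ} (G : (Fin n → Bool) → Fin n × Bool → ℝ) :
    ∑ σ, ∑ i, G σ (i, σ i) = ∑ e : Fin n × Bool, ∑ σ, if σ e.1 = e.2 then G σ e else 0 := by
  rw [Finset.sum_comm, Fintype.sum_prod_type]
  refine Finset.sum_congr rfl fun i _ => ?_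
  rw [Finset.sum_comm]
  refine Finset.sum_congr rfl fun σ _ => ?_
  simp

lemma exists_top_subset {α : Type*} {v : α → ℝ} {s : Finset α} (hv : Set.InjOn v s) {m : ℕ}
    (hm : m ≤ s.card) : ∃ D ⊆ s, D.card = m ∧ ∀ d ∈ D, ∀ e ∈ s, v d < v e → e ∈ D := by
  refine ⟨{e ∈ s | rankIn v s e < m}, Finset.filter_subset _ _, card_rankIn_lt hv hm, ?_⟩
  intro d hd e he h
  exact Finset.mem_filter.2 ⟨he, (rankIn_lt_rankIn he h).trans (Finset.mem_filter.1 hd).2⟩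

/-- The price when the coin flips `σ` select the values and leave the others as samples. -/
noncomputable def coinPrice {n : ℕ} (r : ℕ) (v : Fin n × Bool → ℝ) (σ : Fin n → Bool) : ℝ :=
  largest (fun i => v (i, !σ i)) r

section Coins

variable {n k r : ℕ} {v : Fin n × Bool → ℝ}

lemma le_selected_of_le_card_others {σ : Fin n → Bool} {i : Fin n}
    {D : Finset (Fin n × Bool)} (hr : 1 ≤ r) (hrn : r ≤ n) (hD : D.card + 1 = r + k)
    (htop : ∀ d ∈ D, ∀ e : Fin n × Bool, e.1 ≠ i → v d < v e → e ∈ D)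
    (h : k ≤ Finset.card {j | j ≠ i ∧ coinPrice r v σ < v (j, σ j)}) : k ≤ selected σ D := by
  by_contra! hlt
  have hsplit := Finset.card_filter_add_card_filter_not (s := D) (fun e => σ e.1 = e.2)
  have hY : Finset.card {j | coinPrice r v σ < v (j, !σ j)} < r :=
    (largest_le_iff (fun j => v (j, !σ j)) hr hrn _).1 le_rfl
  obtain ⟨d, hd, hdp⟩ : ∃ d ∈ D, v d ≤ coinPrice r v σ := by
    by_contra! hall
    have hle : Finset.card {e ∈ D | ¬ σ e.1 = e.2} ≤
        Finset.card {j | coinPrice r v σ < v (j, !σ j)} := by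
      refine Finset.card_le_card_of_injOn (fun e => e.1) ?_ ?_
      · rintro ⟨j, b⟩ he
        simp only [Finset.coe_filter, Set.mem_ofPred_eq, Finset.mem_univ, true_and] at he ⊢
        have hb : (!σ j) = b := by
          have := he.2
          revert this
          cases σ j <;> cases b <;> simp
        rw [hb]
        exact hall _ he.1
      · rintro ⟨j, b⟩ he ⟨j', b'⟩ he' (rfl : j = j')
        simp only [Finset.coe_filter, Set.mem_ofPred_eq] at he he'
        have h1 := he.2
        have h2 := he'.2
        revert h1 h2
        cases σ j <;> cases b <;> cases b' <;> simp
    rw [selected] at hlt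
    lia
  have hle : Finset.card {j | j ≠ i ∧ coinPrice r v σ < v (j, σ j)} ≤ selected σ D := by
    refine Finset.card_le_card_of_injOn (fun j => (j, σ j)) ?_ ?_
    · intro j hj
      simp only [Finset.coe_filter, Set.mem_ofPred_eq, Finset.mem_univ, true_and] at hj ⊢
      exact ⟨htop d hd _ hj.1 (hdp.trans_lt hj.2), trivial⟩
    · intro j _ j' _ h
      exact (Prod.mk.inj h).1
  lia

lemma sum_coins_oversold_le (hv : Function.Injective v) (hr : 1 ≤ r) (hrk : r ≤ k)
    (e : Fin n × Bool) :
    ∑ σ : Fin n → Bool, (if σ e.1 = e.2 then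
      (if k ≤ Finset.card {j | j ≠ e.1 ∧ coinPrice r v σ < v (j, σ j)} then (1 : ℝ) else 0)
      else 0) ≤ 2 ^ n * binTail (r + k - 1) k / 2 := by
  rcases le_or_gt n k with hn | hn
  · rw [Finset.sum_eq_zero]
    · have := binTail_nonneg (r + k - 1) k
      positivity
    · intro σ _
      rw [if_neg (c := k ≤ _), ite_self]
      rw [not_le]
      refine lt_of_lt_of_le (Finset.card_lt_card (t := Finset.univ) ?_) (by simpa using hn)
      refine Finset.ssubset_univ_iff.2 fun h => ?_
      have := h.symm ▸ Finset.mem_univ e.1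
      simp at this
  · obtain ⟨D, hDs, hDc, htop⟩ := exists_top_subset (v := v) (m := r + k - 1)
      (s := (Finset.univ.erase e.1) ×ˢ Finset.univ) hv.injOn (by
        rw [Finset.card_product, Finset.card_erase_of_mem (Finset.mem_univ _)]
        simp
        lia)
    have hDe : ∀ d ∈ D, d.1 ≠ e.1 := fun d hd => by
      have := hDs hd
      simp at this
      exact this
    have hbound := sum_coins_le_selected D (k := k) (by lia)
    have hfix := sum_coins_fixed e.1 e.2 (fun σ => if k ≤ selected σ D then (1 : ℝ) else 0) (by
      intro σ c
      have : selected (Function.update σ e.1 c) D = selected σ D := by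
        rw [selected, selected]
        congr 1
        refine Finset.filter_congr fun d hd => ?_
        rw [Function.update_of_ne (hDe d hd)]
      simp only [this])
    rw [← hDc]
    refine le_trans (Finset.sum_le_sum fun σ _ => ?_) (hfix.trans_le (by linarith))
    by_cases hσ : σ e.1 = e.2
    · rw [if_pos hσ, if_pos hσ]
      by_cases h : k ≤ Finset.card {j | j ≠ e.1 ∧ coinPrice r v σ < v (j, σ j)}
      · rw [if_pos h, if_pos]
        exact le_selected_of_le_card_others hr (by lia) (by lia)
          (fun d hd f hf => htop d hd f (by simpa using hf)) h
      · rw [if_neg h]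
        positivity
    · rw [if_neg hσ, if_neg hσ]

lemma sum_coins_le_coinPrice_le (hv : Function.Injective v) (hr : 1 ≤ r) (hrn : r ≤ n)
    (e : Fin n × Bool) (he : rankIn v Finset.univ e < 2 * r) :
    ∑ σ : Fin n → Bool, (if σ e.1 = e.2 then (if v e ≤ coinPrice r v σ then (1 : ℝ) else 0)
      else 0) ≤ 2 ^ n * binTail (rankIn v Finset.univ e) r := by
  refine le_trans (Finset.sum_le_sum fun σ _ => ?_)
    (sum_coins_le_not_selected (Finset.univ.filter fun f => v e < v f) he)
  by_cases hσ : σ e.1 = e.2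
  swap
  · rw [if_neg hσ]
    positivity
  rw [if_pos hσ]
  by_cases h : v e ≤ coinPrice r v σ
  swap
  · rw [if_neg h]
    positivity
  rw [if_pos h, if_pos]
  refine ((le_largest_iff (fun j => v (j, !σ j)) hr hrn _).1 h).trans ?_
  refine Finset.card_le_card_of_injOn (fun j => (j, !σ j)) ?_ ?_
  · intro j hj
    simp only [Finset.coe_filter, Set.mem_ofPred_eq, Finset.mem_univ, true_and] at hj ⊢
    refine ⟨Finset.mem_filter.2 ⟨Finset.mem_univ _, lt_of_le_of_ne hj fun h => ?_⟩, by simp⟩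
    have := hv h
    rw [this] at hσ
    simp at hσ
  · intro j _ j' _ h
    exact (Prod.mk.inj h).1

lemma sum_ite_le_staticWelfare {p : ℝ} {x : Fin n → ℝ} (hx : ∀ i, 0 ≤ x i) :
    ∑ i, (if p < x i ∧ Finset.card {j | p < x j} ≤ k then x i else 0) ≤ staticWelfare k p x := by
  by_cases h : Finset.card {j | p < x j} ≤ k
  · simp [h, staticWelfare_eq_sum h]
  · simp [h, staticWelfare_nonneg k p hx]

lemma sum_coins_sold_ge (hv : Function.Injective v) (hr : 1 ≤ r) (hrk : r ≤ k) (hrn : r ≤ n)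
    (e : Fin n × Bool) (he : rankIn v Finset.univ e < 2 * r) :
    2 ^ n * ((1 - binTail (r + k - 1) k) / 2 - binTail (rankIn v Finset.univ e) r) ≤
    ∑ σ : Fin n → Bool, (if σ e.1 = e.2 then
      (if coinPrice r v σ < v e ∧ Finset.card {j | coinPrice r v σ < v (j, σ j)} ≤ k then (1 : ℝ)
        else 0) else 0) := by
  have h1 := sum_coins_oversold_le hv hr hrk e
  have h2 := sum_coins_le_coinPrice_le hv hr hrn e he
  have h3 := sum_coins_fixed e.1 e.2 (fun _ => (1 : ℝ)) (fun _ _ => rfl)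
  simp only [Finset.sum_const, Finset.card_univ, Fintype.card_fun, Fintype.card_bool,
    Fintype.card_fin, nsmul_eq_mul, mul_one, Nat.cast_pow, Nat.cast_ofNat] at h3
  have h4 : ∑ σ : Fin n → Bool, (if σ e.1 = e.2 then (1 : ℝ) else 0) ≤ _ :=
    Finset.sum_le_sum (f := fun σ : Fin n → Bool => if σ e.1 = e.2 then (1 : ℝ) else 0)
    (g := fun σ => (if σ e.1 = e.2 then
      (if coinPrice r v σ < v e ∧ Finset.card {j | coinPrice r v σ < v (j, σ j)} ≤ k then (1 : ℝ)
        else 0) else 0) + ((if σ e.1 = e.2 then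
      (if k ≤ Finset.card {j | j ≠ e.1 ∧ coinPrice r v σ < v (j, σ j)} then (1 : ℝ) else 0)
      else 0) + (if σ e.1 = e.2 then (if v e ≤ coinPrice r v σ then (1 : ℝ) else 0)
      else 0))) (s := Finset.univ) (fun σ _ => by
      by_cases hσ : σ e.1 = e.2
      · simp only [if_pos hσ]
        by_cases hp : coinPrice r v σ < v e
        · have hc : Finset.card {j | coinPrice r v σ < v (j, σ j)} =
              Finset.card {j | j ≠ e.1 ∧ coinPrice r v σ < v (j, σ j)} + 1 := by
            have hm : e.1 ∈ Finset.univ.filter fun j => coinPrice r v σ < v (j, σ j) := by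
              simp [hσ, hp]
            rw [← Finset.card_erase_add_one hm]
            congr 2
            ext j
            simp
          rw [hc]
          by_cases hk : k ≤ Finset.card {j | j ≠ e.1 ∧ coinPrice r v σ < v (j, σ j)}
          · rw [if_pos hk, if_neg (by lia), if_neg (not_le.2 hp)]
            norm_num
          · rw [if_neg hk, if_pos ⟨hp, by lia⟩, if_neg (not_le.2 hp)]
            norm_num
        · rw [if_pos (not_lt.1 hp)]
          have (q : Prop) [Decidable q] : (0 : ℝ) ≤ if q then 1 else 0 := by positivity
          linarith [this (coinPrice r v σ < v e ∧
              Finset.card {j | coinPrice r v σ < v (j, σ j)} ≤ k),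
            this (k ≤ Finset.card {j | j ≠ e.1 ∧ coinPrice r v σ < v (j, σ j)})]
      · simp [hσ])
  rw [Finset.sum_add_distrib, Finset.sum_add_distrib, h3] at h4
  linarith

lemma sum_top_mul_le_sum_coins_pricing (hv : Function.Injective v) (hpos : ∀ e, 0 ≤ v e)
    (hr : 1 ≤ r) (hrk : r ≤ k) (hrn : r ≤ n) :
    2 ^ n * ((r * (1 - binTail (r + k - 1) k) - ∑ m ∈ Finset.range (2 * r), binTail m r) *
      ∑ e with rankIn v Finset.univ e < 2 * r, v e) ≤
    2 * r * ∑ σ : Fin n → Bool,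
      samplePricingWelfare k r (fun i => v (i, σ i)) (fun i => v (i, !σ i)) := by
  set S : Finset (Fin n × Bool) := {e | rankIn v Finset.univ e < 2 * r} with hS
  set a : ℕ → ℝ := fun m => (1 - binTail (r + k - 1) k) / 2 - binTail m r with ha
  have hcard : 2 * r ≤ (Finset.univ : Finset (Fin n × Bool)).card := by
    simp
    lia
  have hsum : ∑ e ∈ S, a (rankIn v Finset.univ e) =
      r * (1 - binTail (r + k - 1) k) - ∑ m ∈ Finset.range (2 * r), binTail m r := by
    rw [hS, sum_rankIn hv.injOn hcard a, Finset.sum_sub_distrib]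
    simp
    ring
  have hcheb : (∑ e ∈ S, a (rankIn v Finset.univ e)) * ∑ e ∈ S, v e ≤
      S.card * ∑ e ∈ S, a (rankIn v Finset.univ e) * v e := by
    refine MonovaryOn.sum_mul_sum_le_card_mul_sum fun e _ f _ hef => ?_
    have := binTail_monotone_left (r : ℤ) (rankIn_lt_rankIn (Finset.mem_univ f) hef).le
    simp only [ha] at this ⊢
    linarith
  rw [hsum, hS, card_rankIn_lt hv.injOn hcard, ← hS] at hcheb
  have halg : 2 ^ n * ∑ e ∈ S, a (rankIn v Finset.univ e) * v e ≤ ∑ σ : Fin n → Bool,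
      samplePricingWelfare k r (fun i => v (i, σ i)) (fun i => v (i, !σ i)) := by
    refine le_trans ?_ (Finset.sum_le_sum fun σ _ => sum_ite_le_staticWelfare fun i => hpos _)
    have h := sum_coins_sum_selected fun σ e =>
      if coinPrice r v σ < v e ∧ Finset.card {j | coinPrice r v σ < v (j, σ j)} ≤ k then v e else 0
    refine le_trans ?_ h.ge
    rw [Finset.mul_sum]
    refine le_trans (Finset.sum_le_sum fun e he => ?_)
      (Finset.sum_le_sum_of_subset_of_nonneg (Finset.subset_univ S) fun e _ _ => ?_)
    · have h1 := mul_le_mul_of_nonneg_right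
        (sum_coins_sold_ge hv hr hrk hrn e (Finset.mem_filter.1 he).2) (hpos e)
      rw [Finset.sum_mul] at h1
      rw [← mul_assoc]
      refine h1.trans_eq (Finset.sum_congr rfl fun σ _ => ?_)
      simp only [ite_mul, one_mul, zero_mul]
    · refine Finset.sum_nonneg fun σ _ => ?_
      have := hpos e
      split_ifs <;> simp [this]
  push_cast at hcheb
  nlinarith [mul_le_mul_of_nonneg_left hcheb (show (0 : ℝ) ≤ 2 ^ n by positivity),
    mul_le_mul_of_nonneg_left halg (show (0 : ℝ) ≤ 2 * r by positivity)]

lemma sum_coins_prophetWelfare_le (hv : Function.Injective v) (hpos : ∀ e, 0 ≤ v e)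
    (hr : 1 ≤ r) (hrk : r ≤ k) (hrn : r ≤ n) :
    2 * r * ∑ σ : Fin n → Bool, prophetWelfare k (fun i => v (i, σ i)) ≤
      2 ^ n * (k * ∑ e with rankIn v Finset.univ e < 2 * r, v e) := by
  set S : Finset (Fin n × Bool) := {e | rankIn v Finset.univ e < 2 * r} with hS
  have hcard : S.card = 2 * r := card_rankIn_lt hv.injOn (by simp; lia)
  obtain ⟨m, hmS, hm⟩ := S.exists_min_image v (Finset.card_pos.1 (by lia))
  have h1 : ∑ σ : Fin n → Bool, prophetWelfare k (fun i => v (i, σ i)) ≤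
      2 ^ n * (k * v m) + 2 ^ n / 2 * ∑ e, max (v e - v m) 0 := by
    refine (Finset.sum_le_sum fun σ _ => prophetWelfare_le k _ (hpos m)).trans_eq ?_
    rw [Finset.sum_add_distrib, sum_coins_sum_selected fun _ e => max (v e - v m) 0,
      Finset.mul_sum]
    congr 1
    · simp
    · refine Finset.sum_congr rfl fun e _ => ?_
      rw [sum_coins_fixed e.1 e.2 (fun _ => max (v e - v m) 0) fun _ _ => rfl]
      simp
      ring
  have h2 : ∑ e, max (v e - v m) 0 = ∑ e ∈ S, v e - 2 * r * v m := by
    rw [← Finset.sum_subset (Finset.subset_univ S)]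
    · rw [Finset.sum_congr rfl fun e he => max_eq_left (sub_nonneg.2 (hm e he)),
        Finset.sum_sub_distrib]
      simp [hcard]
    · intro e _ he
      refine max_eq_right (sub_nonpos.2 ?_)
      by_contra! hlt
      exact he (Finset.mem_filter.2 ⟨Finset.mem_univ _,
        (rankIn_lt_rankIn (Finset.mem_univ e) hlt).trans (Finset.mem_filter.1 hmS).2⟩)
  have h3 : 2 * r * v m ≤ ∑ e ∈ S, v e := by
    have := Finset.card_nsmul_le_sum S v (v m) hm
    rw [hcard, nsmul_eq_mul] at this
    exact_mod_cast this
  rw [h2] at h1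
  have hk : (0 : ℝ) ≤ k - r := sub_nonneg.2 (by exact_mod_cast hrk)
  have h4 := mul_le_mul_of_nonneg_left h1 (show (0 : ℝ) ≤ 2 * r by positivity)
  refine h4.trans ?_
  have h5 := mul_le_mul_of_nonneg_left (mul_le_mul_of_nonneg_left h3 hk)
    (show (0 : ℝ) ≤ 2 ^ n by positivity)
  linarith

/-- The bound on the competitive ratio, for the pairs of values whose order is decided by coins. -/
lemma mul_sum_coins_prophetWelfare_le (hv : Function.Injective v) (hpos : ∀ e, 0 < v e)
    (hr : 1 ≤ r) (hrk : r ≤ k) :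
    ((r * (1 - binTail (r + k - 1) k) - ∑ m ∈ Finset.range (2 * r), binTail m r) / k) *
      ∑ σ : Fin n → Bool, prophetWelfare k (fun i => v (i, σ i)) ≤
    ∑ σ : Fin n → Bool,
      samplePricingWelfare k r (fun i => v (i, σ i)) (fun i => v (i, !σ i)) := by
  have hk : (0 : ℝ) < k := by exact_mod_cast hr.trans hrk
  have hr0 : (0 : ℝ) < r := by exact_mod_cast hr
  set c := r * (1 - binTail (r + k - 1) k) - ∑ m ∈ Finset.range (2 * r), binTail m r with hc
  have hopt : 0 ≤ ∑ σ : Fin n → Bool, prophetWelfare k (fun i => v (i, σ i)) :=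
    Finset.sum_nonneg fun σ _ => prophetWelfare_nonneg k fun i => (hpos _).le
  rcases le_or_gt c 0 with hc0 | hc0
  · refine (mul_nonpos_of_nonpos_of_nonneg (div_nonpos_of_nonpos_of_nonneg hc0 hk.le) hopt).trans ?_
    exact Finset.sum_nonneg fun σ _ => samplePricingWelfare_nonneg k r _ fun i => (hpos _).le
  rcases le_or_gt r n with hrn | hrn
  · have h1 := sum_top_mul_le_sum_coins_pricing hv (fun e => (hpos e).le) hr hrk hrn
    have h2 := sum_coins_prophetWelfare_le hv (fun e => (hpos e).le) hr hrk hrn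
    rw [← hc] at h1
    have h3 := mul_le_mul_of_nonneg_left h2 (div_pos hc0 hk).le
    refine le_of_mul_le_mul_left ?_ (show (0 : ℝ) < 2 * r by positivity)
    refine le_trans (le_of_eq (by ring)) (h3.trans (le_trans (le_of_eq ?_) h1))
    field_simp
  · have hc1 : c / k ≤ 1 := by
      rw [div_le_one hk]
      have h1 := binTail_nonneg (r + k - 1) k
      have h2 : 0 ≤ ∑ m ∈ Finset.range (2 * r), binTail m r :=
        Finset.sum_nonneg fun m _ => binTail_nonneg m r
      have h3 : (r : ℝ) ≤ k := by exact_mod_cast hrk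
      nlinarith
    refine (mul_le_of_le_one_left hopt hc1).trans (Finset.sum_le_sum fun σ _ => ?_)
    refine (prophetWelfare_le k _ le_rfl).trans (le_of_eq ?_)
    rw [samplePricingWelfare, largest_of_lt _ hrn, staticWelfare_eq_sum]
    · simp only [mul_zero, zero_add, sub_zero]
      refine Finset.sum_congr rfl fun i _ => ?_
      rw [if_pos (hpos _), max_eq_left (hpos _).le]
    · refine (Finset.card_filter_le _ _).trans ?_
      simp
      lia

end Coins

/-- Two independent random variables, one of them without atoms, are almost surely distinct. -/
lemma ae_ne_of_indepFun {Ω : Type*} [MeasurableSpace Ω] {P : Measure Ω} [IsProbabilityMeasure P]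
    {f g : Ω → ℝ} (hf : Measurable f) (hg : Measurable g) (h : IndepFun f g P)
    (hg0 : ∀ a, P {ω | g ω = a} = 0) : ∀ᵐ ω ∂P, f ω ≠ g ω := by
  have hlaw := (indepFun_iff_map_prod_eq_prod_map_map hf.aemeasurable hg.aemeasurable).1 h
  have := Measure.isProbabilityMeasure_map (μ := P) hg.aemeasurable
  have hdiag : MeasurableSet {z : ℝ × ℝ | z.1 = z.2} :=
    measurableSet_eq_fun measurable_fst measurable_snd
  have h0 : (P.map fun ω => (f ω, g ω)) {z : ℝ × ℝ | z.1 = z.2} = 0 := by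
    rw [hlaw, Measure.measure_prod_null hdiag]
    refine Filter.Eventually.of_forall fun a => ?_
    change P.map g (Prod.mk a ⁻¹' {z : ℝ × ℝ | z.1 = z.2}) = 0
    have e : Prod.mk a ⁻¹' {z : ℝ × ℝ | z.1 = z.2} = {a} := by
      ext b
      simp [eq_comm]
    rw [e, Measure.map_apply hg (measurableSet_singleton a)]
    exact hg0 a
  rw [Measure.map_apply (hf.prodMk hg) hdiag] at h0
  rw [ae_iff]
  simpa using h0

section Instance

variable {Ω : Type*} [MeasurableSpace Ω] {P : Measure Ω} {n : ℕ} {X Y : Fin n → Ω → ℝ}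

/-- The values and samples as one family: `(i, true)` is the value of buyer `i`, and `(i, false)`
the sample. -/
def pairs (X Y : Fin n → Ω → ℝ) (e : Fin n × Bool) : Ω → ℝ :=
  if e.2 then X e.1 else Y e.1

namespace IsSingleSampleInstance

lemma measurable_pairs (h : IsSingleSampleInstance P X Y) (e : Fin n × Bool) :
    Measurable (pairs X Y e) := by
  rw [pairs]
  split_ifs
  exacts [h.measurable_value _, h.measurable_sample _]

lemma identDistrib_pairs (h : IsSingleSampleInstance P X Y) (i : Fin n) (b c : Bool) :
    IdentDistrib (pairs X Y (i, b)) (pairs X Y (i, c)) P P := by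
  cases b <;> cases c
  · exact IdentDistrib.refl (h.measurable_sample i).aemeasurable
  · exact (h.identDistrib i).symm
  · exact h.identDistrib i
  · exact IdentDistrib.refl (h.measurable_value i).aemeasurable

lemma iIndepFun_pairs (h : IsSingleSampleInstance P X Y) : iIndepFun (pairs X Y) P := by
  have hg : Function.Injective fun e : Fin n × Bool =>
      if e.2 then (Sum.inl e.1 : Fin n ⊕ Fin n) else Sum.inr e.1 := by
    rintro ⟨i, b⟩ ⟨j, c⟩ h
    cases b <;> cases c <;> simp_all
  convert h.indep.precomp hg using 1
  funext e
  rcases e with ⟨i, b⟩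
  cases b <;> rfl

lemma noAtoms_pairs (h : IsSingleSampleInstance P X Y) (e : Fin n × Bool) (a : ℝ) :
    P {ω | pairs X Y e ω = a} = 0 := by
  have h1 := (h.identDistrib_pairs e.1 e.2 true).measure_mem_eq (measurableSet_singleton a)
  exact h1.trans (h.noAtoms e.1 a)

lemma ae_pos_pairs (h : IsSingleSampleInstance P X Y) (e : Fin n × Bool) :
    ∀ᵐ ω ∂P, 0 < pairs X Y e ω := by
  have h1 := (h.identDistrib_pairs e.1 e.2 true).measure_mem_eq (measurableSet_Iio (a := (0 : ℝ)))
  have h2 : P (pairs X Y (e.1, true) ⁻¹' Set.Iio 0) = 0 := by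
    have := h.nonneg e.1
    rw [ae_iff] at this
    simp only [not_le] at this
    exact this
  have h3 : ∀ᵐ ω ∂P, ¬ pairs X Y e ω < 0 := by
    rw [ae_iff]
    simp only [not_not]
    exact h1.trans h2
  have h4 : ∀ᵐ ω ∂P, pairs X Y e ω ≠ 0 := by
    rw [ae_iff]
    simp only [not_not]
    exact h.noAtoms_pairs e 0
  filter_upwards [h3, h4] with ω h3 h4
  exact lt_of_le_of_ne (not_lt.1 h3) h4.symm

lemma ae_injective_pairs [IsProbabilityMeasure P] (h : IsSingleSampleInstance P X Y) :
    ∀ᵐ ω ∂P, Function.Injective fun e => pairs X Y e ω := by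
  have h1 : ∀ᵐ ω ∂P, ∀ e f : Fin n × Bool, e ≠ f → pairs X Y e ω ≠ pairs X Y f ω := by
    rw [ae_all_iff]
    intro e
    rw [ae_all_iff]
    intro f
    by_cases hef : e = f
    · simp [hef]
    · filter_upwards [ae_ne_of_indepFun (h.measurable_pairs e) (h.measurable_pairs f)
        (h.iIndepFun_pairs.indepFun hef) (h.noAtoms_pairs f)] with ω hω _
      exact hω
  filter_upwards [h1] with ω hω e f hef
  by_contra hne
  exact hω e f hne hef

lemma lintegral_swap [IsProbabilityMeasure P] (h : IsSingleSampleInstance P X Y)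
    {F : (Fin n → ℝ) × (Fin n → ℝ) → ENNReal} (hF : Measurable F) (σ : Fin n → Bool) :
    ∫⁻ ω, F (fun i => pairs X Y (i, σ i) ω, fun i => pairs X Y (i, !σ i) ω) ∂P =
      ∫⁻ ω, F (fun i => X i ω, fun i => Y i ω) ∂P := by
  set τ : Fin n × Bool → Fin n × Bool := fun e => (e.1, e.2 == σ e.1) with hτ
  have hτi : Function.Injective τ := by
    rintro ⟨i, b⟩ ⟨j, c⟩ hij
    simp only [hτ, Prod.mk.injEq] at hij
    obtain ⟨rfl, hbc⟩ := hij
    revert hbc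
    cases b <;> cases c <;> cases σ i <;> simp
  have hm := h.measurable_pairs
  have h1 := (iIndepFun_iff_map_fun_eq_pi_map fun e => (hm e).aemeasurable).1 h.iIndepFun_pairs
  have h2 := (iIndepFun_iff_map_fun_eq_pi_map fun e => (hm (τ e)).aemeasurable).1
    (h.iIndepFun_pairs.precomp hτi)
  have hlaw : P.map (fun ω e => pairs X Y (τ e) ω) = P.map (fun ω e => pairs X Y e ω) := by
    rw [h1, h2]
    congr 1
    funext e
    exact (h.identDistrib_pairs e.1 _ _).map_eq
  set G : (Fin n × Bool → ℝ) → ENNReal := fun w => F (fun i => w (i, true), fun i => w (i, false))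
  have hG : Measurable G := hF.comp (by fun_prop)
  have h3 : ∫⁻ ω, G (fun e => pairs X Y (τ e) ω) ∂P = ∫⁻ ω, G (fun e => pairs X Y e ω) ∂P := by
    rw [← lintegral_map hG (measurable_pi_lambda _ fun e => hm (τ e)), hlaw,
      lintegral_map hG (measurable_pi_lambda _ hm)]
  refine Eq.trans (lintegral_congr fun ω => ?_) h3
  simp [G, hτ]

end IsSingleSampleInstance

end Instance

theorem hasCompetitiveRatio_binTail {k r : ℕ} (hr : 1 ≤ r) (hrk : r ≤ k) :
    HasCompetitiveRatio.{u} k r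
      ((r * (1 - binTail (r + k - 1) k) - ∑ m ∈ Finset.range (2 * r), binTail m r) / k) := by
  intro Ω _ P _ n X Y h
  set c := (r * (1 - binTail (r + k - 1) k) - ∑ m ∈ Finset.range (2 * r), binTail m r) / (k : ℝ)
  have hm := h.measurable_pairs
  have hFo : Measurable fun z : (Fin n → ℝ) × (Fin n → ℝ) =>
      ENNReal.ofReal (prophetWelfare k z.1) :=
    ((measurable_prophetWelfare k).comp measurable_fst).ennreal_ofReal
  have hFa : Measurable fun z : (Fin n → ℝ) × (Fin n → ℝ) =>
      ENNReal.ofReal (samplePricingWelfare k r z.1 z.2) :=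
    (measurable_samplePricingWelfare k r).ennreal_ofReal
  have hw (σ : Fin n → Bool) : Measurable fun ω =>
      ((fun i => pairs X Y (i, σ i) ω, fun i => pairs X Y (i, !σ i) ω) :
        (Fin n → ℝ) × (Fin n → ℝ)) :=
    (measurable_pi_lambda _ fun i => hm _).prodMk (measurable_pi_lambda _ fun i => hm _)
  have avg {F : (Fin n → ℝ) × (Fin n → ℝ) → ENNReal} (hF : Measurable F) :
      2 ^ n * ∫⁻ ω, F (fun i => X i ω, fun i => Y i ω) ∂P = ∫⁻ ω, ∑ σ : Fin n → Bool,
        F (fun i => pairs X Y (i, σ i) ω, fun i => pairs X Y (i, !σ i) ω) ∂P := by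
    rw [lintegral_finsetSum (f := fun σ ω => F (fun i => pairs X Y (i, σ i) ω,
      fun i => pairs X Y (i, !σ i) ω)) _ fun σ _ => hF.comp (hw σ),
      Finset.sum_congr rfl fun σ _ => h.lintegral_swap hF σ]
    simp
  have key : 2 ^ n * (ENNReal.ofReal c *
      ∫⁻ ω, ENNReal.ofReal (prophetWelfare k fun i => X i ω) ∂P) ≤
      2 ^ n * ∫⁻ ω, ENNReal.ofReal
        (samplePricingWelfare k r (fun i => X i ω) fun i => Y i ω) ∂P := by
    rw [mul_left_comm, avg hFo, avg hFa, ← lintegral_const_mul' _ _ ENNReal.ofReal_ne_top]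
    refine lintegral_mono_ae ?_
    filter_upwards [h.ae_injective_pairs, ae_all_iff.2 h.ae_pos_pairs] with ω hinj hpos
    rw [← ENNReal.ofReal_sum_of_nonneg fun σ _ => prophetWelfare_nonneg k fun i => (hpos _).le,
      ← ENNReal.ofReal_sum_of_nonneg fun σ _ =>
        samplePricingWelfare_nonneg k r _ fun i => (hpos _).le,
      ← ENNReal.ofReal_mul' (Finset.sum_nonneg fun σ _ =>
        prophetWelfare_nonneg k fun i => (hpos _).le)]
    exact ENNReal.ofReal_le_ofReal (mul_sum_coins_prophetWelfare_le hinj hpos hr hrk)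
  exact (ENNReal.mul_le_mul_iff_right (by simp) (by simp)).1 key

lemma HasCompetitiveRatio.mono {k r : ℕ} {c d : ℝ} (h : HasCompetitiveRatio.{u} k r c)
    (hdc : d ≤ c) : HasCompetitiveRatio.{u} k r d := fun Ω _ P _ n X Y hXY =>
  le_trans (by gcongr) (h Ω P n X Y hXY)

lemma binTail_le_inv_sqrt {k r : ℕ} (hr : 1 ≤ r) (hrk : r ≤ k)
    (h : √(2 * k * Real.log k) ≤ k - r + 1) : binTail (r + k - 1) k ≤ 1 / √k := by
  have hk : (0 : ℝ) < k := by exact_mod_cast hr.trans hrk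
  have hk1 : (1 : ℝ) ≤ k := by exact_mod_cast hr.trans hrk
  have hlog : 0 ≤ Real.log k := Real.log_nonneg hk1
  have hrk' : (r : ℝ) ≤ k := by exact_mod_cast hrk
  set d : ℝ := k - r + 1 with hd
  have hd2 : 2 * k * Real.log k ≤ d ^ 2 := by
    rw [← Real.sq_sqrt (show 0 ≤ 2 * k * Real.log k by positivity)]
    gcongr
  have hd0 : 0 ≤ d := by linarith
  refine (binTail_le_exp (r + k - 1) k (d / k) (by positivity)).trans ?_
  have e : 1 / √k = Real.exp (-(Real.log k / 2)) := by
    rw [Real.exp_neg, one_div, Real.sqrt_eq_rpow, Real.rpow_def_of_pos hk]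
    congr 2
    ring
  rw [e, Real.exp_le_exp]
  have hm : ((r + k - 1 : ℕ) : ℝ) = 2 * k - d := by
    rw [Nat.cast_sub (by lia), hd]
    push_cast
    ring
  rw [hm]
  push_cast
  have h1 : Real.log k / 2 ≤ d ^ 2 / k / 4 := by
    rw [div_div, div_le_div_iff₀ (by norm_num) (by positivity)]
    linarith
  have h2 : -(d / k) * k + (2 * k - d) * (d / k / 2 + (d / k) ^ 2 / 8) =
      -(d ^ 2 / k / 4) - d * ((d / k) ^ 2 / 8) := by
    field_simp
    ring
  rw [h2]
  have : 0 ≤ d * ((d / k) ^ 2 / 8) := by positivity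
  linarith

lemma one_sub_sqrt_le {k r : ℕ} (hr : 1 ≤ r) (hrk : r ≤ k)
    (h : |(r : ℝ) - ((k : ℝ) - √(2 * k * Real.log k))| < 1) :
    1 - √(2 * Real.log k / k) - 3 / √k ≤
      (r * (1 - binTail (r + k - 1) k) - ∑ m ∈ Finset.range (2 * r), binTail m r) / k := by
  have hk : (0 : ℝ) < k := by exact_mod_cast hr.trans hrk
  have hk1 : (1 : ℝ) ≤ k := by exact_mod_cast hr.trans hrk
  have hrk' : (r : ℝ) ≤ k := by exact_mod_cast hrk
  rw [abs_lt] at h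
  have h1 := binTail_le_inv_sqrt hr hrk (by linarith)
  have h2 := (sum_range_two_mul_binTail hr).trans_le (mul_choose_div_le_sqrt hr)
  have h3 : √(r : ℝ) ≤ √k := Real.sqrt_le_sqrt hrk'
  have hs : 0 < √(k : ℝ) := Real.sqrt_pos.2 hk
  have hss : √(k : ℝ) * √k = k := Real.mul_self_sqrt hk.le
  have hs1 : 1 ≤ √(k : ℝ) := Real.one_le_sqrt.2 hk1
  have e : √(2 * k * Real.log k) = k * √(2 * Real.log k / k) := by
    rw [show 2 * k * Real.log k = (k : ℝ) ^ 2 * (2 * Real.log k / k) by field_simp,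
      Real.sqrt_mul (by positivity), Real.sqrt_sq hk.le]
  have e2 : 3 / √(k : ℝ) * k = 3 * √k := by
    rw [div_mul_eq_mul_div, div_eq_iff hs.ne', mul_assoc, hss]
  have h4 : r * binTail (r + k - 1) k ≤ √k := by
    have : (r : ℝ) * binTail (r + k - 1) k ≤ k * (1 / √k) :=
      mul_le_mul hrk' h1 (binTail_nonneg _ _) hk.le
    rwa [mul_one_div, Real.div_sqrt] at this
  rw [le_div_iff₀ hk, sub_mul, sub_mul, e2, one_mul, mul_comm (√_), ← e]
  linarith

lemma isLittleO_one_div_sqrt :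
    (fun k : ℕ => 1 / √(k : ℝ)) =o[atTop] fun k : ℕ => √(Real.log k / k) := by
  have hlim : Tendsto (fun k : ℕ => 1 / √(Real.log k)) atTop (nhds 0) := by
    simp only [one_div]
    exact (Real.tendsto_sqrt_atTop.comp
      (Real.tendsto_log_atTop.comp tendsto_natCast_atTop_atTop)).inv_tendsto_atTop
  have h1 := ((isLittleO_one_iff ℝ).2 hlim).mul_isBigO
    (isBigO_refl (fun k : ℕ => √(Real.log k / k)) atTop)
  refine (h1.congr' ?_ (by simp))
  filter_upwards [eventually_ge_atTop 2] with k hk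
  have hk1 : (1 : ℝ) < k := by exact_mod_cast hk
  have hl := Real.log_pos hk1
  have := Real.sqrt_pos.2 hl
  rw [Real.sqrt_div hl.le]
  field_simp

end SampleProphet

theorem theorem2 :
    (∀ k r : ℕ, 1 ≤ r → r ≤ k →
      SampleProphet.HasCompetitiveRatio.{u} k r
        (((r : ℝ) * (binomial (r + k - 1) SampleProphet.half).real {z : ℕ | z ≤ k - 1} -
          (r : ℝ) * (((2 * r - 1).choose r : ℝ) / 2 ^ (2 * r - 1))) / (k : ℝ))) ∧
    ∃ ε : ℕ → ℝ,
      (ε =O[atTop] fun k : ℕ => 1 / Real.sqrt (k : ℝ)) ∧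
      (ε =o[atTop] fun k : ℕ => Real.sqrt (Real.log (k : ℝ) / (k : ℝ))) ∧
      ∀ k r : ℕ, 1 ≤ r → r ≤ k →
        |(r : ℝ) - ((k : ℝ) - Real.sqrt (2 * (k : ℝ) * Real.log (k : ℝ)))| < 1 →
        SampleProphet.HasCompetitiveRatio.{u} k r
          (1 - Real.sqrt (2 * Real.log (k : ℝ) / (k : ℝ)) - ε k) := by
  constructor
  · intro k r hr hrk
    have h := SampleProphet.hasCompetitiveRatio_binTail.{u} hr hrk
    rwa [SampleProphet.sum_range_two_mul_binTail hr,
      ← SampleProphet.binomial_half_real_le (hr.trans hrk)] at h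
  · have h3 : (fun k : ℕ => 3 / √(k : ℝ)) =O[atTop] fun k : ℕ => 1 / √(k : ℝ) := by
      simpa only [mul_one_div] using
        (isBigO_refl (fun k : ℕ => 1 / √(k : ℝ)) atTop).const_mul_left 3
    exact ⟨fun k => 3 / √k, h3, h3.trans_isLittleO SampleProphet.isLittleO_one_div_sqrt,
      fun k r hr hrk h => (SampleProphet.hasCompetitiveRatio_binTail hr hrk).mono
        (SampleProphet.one_sub_sqrt_le hr hrk h)⟩
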